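/- Consider a hybrid inclusion $\mathcal H=(C,F,D,G)$ on $\mathbb R^n$, i.e. $\dot x\in F(x)$ for $x\in C$ and $x^+\in G(x)$ for $x\in D$, where $C,D\subset\mathbb R^n$ and $F,G:\mathbb R^n\rightrightarrows\mathbb R^n$ are set-valued maps. Assume that $F$ is outer semicontinuous and locally bounded with nonempty convex images on $C$, and that $G(x)\neq\emptyset$ for all $x\in D$. A hybrid time domain is a nonempty set $E\subset\mathbb R_{\ge0}\times\mathbb N$ such that for each $(T,J)\in E$ there are $0=t_0\le t_1\le\dots\le t_{J+1}$ with $E\cap([0,T]\times\{0,\dots,J\})=\bigcup_{j=0}^{J}[t_j,t_{j+1}]\times\{j\}$. A solution to $\mathcal H$ is a function $x:\operatorname{dom}x\to\mathbb R^n$ on a hybrid time domain, with $t\mapsto x(t,j)$ locally absolutely continuous on $I^j:=\{t:(t,j)\in\operatorname{dom}x\}$ for each $j$, such that $x(0,0)\in\operatorname{cl}(C)\cup D$; for every $j$ such that $I^j$ has nonempty interior, $x(t,j)\in C$ for all $t\in\operatorname{int}(I^j)$ and $\dot x(t,j)\in F(x(t,j))$ for almost all $t\in I^j$; and $x(t,j)\in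 D$, $x(t,j+1)\in G(x(t,j))$ whenever $(t,j),(t,j+1)\in\operatorname{dom}x$. A solution is maximal if no solution on a strictly larger domain extends it. A set $K$ is forward pre-invariant for $\mathcal H$ if every maximal solution $x$ with $x(0,0)\in K$ satisfies $x(t,j)\in K$ for all $(t,j)\in\operatorname{dom}x$. Let $B:\mathbb R^n\to\mathbb R$ be locally Lipschitz, and suppose that $K=\{x\in C\cup D: B(x)\le 0\}$ is closed. Let $T_C(x)=\{v\in\mathbb R^n:\liminf_{h\to0^+}\operatorname{dist}(x+hv,C)/h=0\}$ be the contingent cone of $C$ at $x$, and let $$\partial_C B(x)=\operatorname{co}\Big\{\lim_{i\to\infty}\nabla B(x_i): x_i\to x,\ B\text{ differentiable at }x_i,\ x_i\notin\Omega\Big\}$$ be the Clarke generalized gradient of $B$, where $\Omega\subset\mathbb R^n$ is any set of Lebesgue measure zero. Suppose that \begin{align*} & B(\eta)\le 0 \quad \forall \eta\in G(x),\ \forall x\in D\cap K,\\ & G(x)\subset C\cup D\quad \forall x\in D\cap K, \end{align*} and that there is an open neighborhood $U(\partial K)$ of the boundary $\partial K$ of $K$ such that $$\max_{\zeta\in\partial_C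 B(x)}\langle\zeta,\eta\rangle\le 0\qquad \forall \eta\in F(x)\cap T_C(x),\ \forall x\in (U(\partial K)\setminus K)\cap C.$$ Then $K$ is forward pre-invariant for $\mathcal H$. -/

import Mathlib

open Set Filter Topology MeasureTheory

noncomputable section

/-- The data `(C, F, D, G)` of a hybrid inclusion on `ℝⁿ`:
`ẋ ∈ F(x)` while `x ∈ C`, and `x⁺ ∈ G(x)` when `x ∈ D`. -/
structure HybridSystem (n : ℕ) where
  /-- the flow set -/
  C : Set (EuclideanSpace ℝ (Fin n))
  /-- the flow map -/
  F : EuclideanSpace ℝ (Fin n) → Set (EuclideanSpace ℝ (Fin n))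
  /-- the jump set -/
  D : Set (EuclideanSpace ℝ (Fin n))
  /-- the jump map -/
  G : EuclideanSpace ℝ (Fin n) → Set (EuclideanSpace ℝ (Fin n))

/-- Hybrid time domains: nonempty subsets `E` of `ℝ≥0 × ℕ` such that, for each `(T, J) ∈ E`, the
truncation `E ∩ ([0, T] × {0, …, J})` is `⋃_{j ≤ J} [t_j, t_{j+1}] × {j}` for some
`0 = t_0 ≤ t_1 ≤ … ≤ t_{J+1}`. -/
def IsHybridTimeDomain (E : Set (ℝ × ℕ)) : Prop :=
  E.Nonempty ∧ (∀ p ∈ E, 0 ≤ p.1) ∧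
  ∀ T : ℝ, ∀ J : ℕ, (T, J) ∈ E →
    ∃ t : ℕ → ℝ, t 0 = 0 ∧ (∀ j ≤ J, t j ≤ t (j + 1)) ∧
      E ∩ (Icc 0 T ×ˢ Iic J) = ⋃ j ∈ Iic J, Icc (t j) (t (j + 1)) ×ˢ {j}

/-- The set `I^j = {t : (t, j) ∈ E}`. -/
def timeSlice (E : Set (ℝ × ℕ)) (j : ℕ) : Set ℝ := {t | (t, j) ∈ E}

/-- A hybrid arc: a function on a hybrid time domain `dom` such that each `t ↦ x(t, j)` is
absolutely continuous on every compact subinterval of `I^j`. The values of `val` outside `dom`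
are irrelevant. -/
structure HybridArc (n : ℕ) where
  dom : Set (ℝ × ℕ)
  val : ℝ → ℕ → EuclideanSpace ℝ (Fin n)
  isHybridTimeDomain : IsHybridTimeDomain dom
  absolutelyContinuous : ∀ j : ℕ, ∀ a b : ℝ, a ≤ b → Icc a b ⊆ timeSlice dom j →
    AbsolutelyContinuousOnInterval (fun t => val t j) a b

/-- `x` is a solution to the hybrid system `H`. -/
structure HybridSystem.IsSolution {n : ℕ} (H : HybridSystem n) (x : HybridArc n) : Prop where
  initial : x.val 0 0 ∈ closure H.C ∪ H.D
  flow_mem : ∀ j : ℕ, (interior (timeSlice x.dom j)).Nonempty →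
    ∀ t ∈ interior (timeSlice x.dom j), x.val t j ∈ H.C
  flow_deriv : ∀ j : ℕ, (interior (timeSlice x.dom j)).Nonempty →
    ∀ᵐ t ∂(volume : Measure ℝ), t ∈ timeSlice x.dom j →
      ∃ v ∈ H.F (x.val t j),
        HasDerivWithinAt (fun s => x.val s j) v (timeSlice x.dom j) t
  jump : ∀ t : ℝ, ∀ j : ℕ, (t, j) ∈ x.dom → (t, j + 1) ∈ x.dom →
    x.val t j ∈ H.D ∧ x.val t (j + 1) ∈ H.G (x.val t j)

/-- `x` is a maximal solution: no solution properly extends it. -/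
def HybridSystem.IsMaximalSolution {n : ℕ} (H : HybridSystem n) (x : HybridArc n) : Prop :=
  H.IsSolution x ∧
    ¬ ∃ y : HybridArc n, H.IsSolution y ∧ x.dom ⊂ y.dom ∧
      ∀ p ∈ x.dom, x.val p.1 p.2 = y.val p.1 p.2

/-- `K` is forward pre-invariant: every maximal solution starting from a point of `K` stays
in `K`. -/
def HybridSystem.ForwardPreInvariant {n : ℕ} (H : HybridSystem n)
    (K : Set (EuclideanSpace ℝ (Fin n))) : Prop :=
  ∀ x₀ ∈ K, ∀ x : HybridArc n, H.IsMaximalSolution x → x.val 0 0 = x₀ →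
    ∀ t : ℝ, ∀ j : ℕ, (t, j) ∈ x.dom → x.val t j ∈ K

/-- Outer semicontinuity of a set-valued map on (relative to) a set. -/
def OuterSemicontinuousOn {n : ℕ}
    (F : EuclideanSpace ℝ (Fin n) → Set (EuclideanSpace ℝ (Fin n)))
    (C : Set (EuclideanSpace ℝ (Fin n))) : Prop :=
  ∀ x ∈ C, ∀ y : EuclideanSpace ℝ (Fin n), ∀ u v : ℕ → EuclideanSpace ℝ (Fin n),
    (∀ i, u i ∈ C) → (∀ i, v i ∈ F (u i)) →
    Tendsto u atTop (𝓝 x) → Tendsto v atTop (𝓝 y) → y ∈ F x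

/-- Local boundedness of a set-valued map on (relative to) a set. -/
def LocallyBoundedOn {n : ℕ}
    (F : EuclideanSpace ℝ (Fin n) → Set (EuclideanSpace ℝ (Fin n)))
    (C : Set (EuclideanSpace ℝ (Fin n))) : Prop :=
  ∀ x ∈ C, ∃ U : Set (EuclideanSpace ℝ (Fin n)), IsOpen U ∧ x ∈ U ∧
    ∃ k : ℝ, 0 < k ∧ ∀ y ∈ U ∩ C, ∀ ζ ∈ F y, ‖ζ‖ ≤ k

/-- The regularity imposed on the data of a hybrid system: `F` is outer semicontinuous and locally
bounded with nonempty convex images on `C`, and `G` has nonempty images on `D`. -/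
structure HybridSystem.Regular {n : ℕ} (H : HybridSystem n) : Prop where
  outerSemicontinuous : OuterSemicontinuousOn H.F H.C
  locallyBounded : LocallyBoundedOn H.F H.C
  flow_nonempty : ∀ x ∈ H.C, (H.F x).Nonempty
  flow_convex : ∀ x ∈ H.C, Convex ℝ (H.F x)
  jump_nonempty : ∀ x ∈ H.D, (H.G x).Nonempty

/-- `B` is a scalar barrier function candidate defining `K`, i.e. `K = {x ∈ C ∪ D : B(x) ≤ 0}`. -/
def HybridSystem.IsBarrierCandidate {n : ℕ} (H : HybridSystem n)
    (B : EuclideanSpace ℝ (Fin n) → ℝ) (K : Set (EuclideanSpace ℝ (Fin n))) : Prop :=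
  K = {x | x ∈ H.C ∪ H.D ∧ B x ≤ 0}

/-- The contingent cone `T_S(x) = {v : liminf_{h → 0⁺} dist(x + h v, S) / h = 0}`; distances are
taken in `[0, ∞]`. -/
def contingentCone {n : ℕ} (S : Set (EuclideanSpace ℝ (Fin n))) (x : EuclideanSpace ℝ (Fin n)) :
    Set (EuclideanSpace ℝ (Fin n)) :=
  {v | liminf (fun h : ℝ => Metric.infEDist (x + h • v) S / ENNReal.ofReal h) (𝓝[>] 0) = 0}

/-- The Clarke generalized gradient of a locally Lipschitz function `B` at `x`: the convex hull of
all limits of gradients `∇B(x_i)` along sequences `x_i → x` of points of differentiability of `B`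
that avoid the set `Ω`. Here `Ω` is any Lebesgue-null set (on which the generalized gradient does
not depend). -/
def clarkeGradient {n : ℕ} (Ω : Set (EuclideanSpace ℝ (Fin n)))
    (B : EuclideanSpace ℝ (Fin n) → ℝ) (x : EuclideanSpace ℝ (Fin n)) :
    Set (EuclideanSpace ℝ (Fin n)) :=
  convexHull ℝ {ζ | ∃ u : ℕ → EuclideanSpace ℝ (Fin n), Tendsto u atTop (𝓝 x) ∧
    (∀ i, DifferentiableAt ℝ B (u i)) ∧ (∀ i, u i ∉ Ω) ∧
    Tendsto (fun i => gradient B (u i)) atTop (𝓝 ζ)}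

end

/-! A jump from `K` lands in `K` by the two jump conditions, so by induction on `j` only flows
matter. A flow leaving `K` has a last time `s` in the closed set `K`; its position then is on the
boundary, and just afterwards it lies in `(U \ K) ∩ C`. There its velocity is a.e. in `F` and in the
contingent cone of `C`, so `B` along it is absolutely continuous with derivative a.e. at most `0`,
hence still `≤ 0` just after `s`. As the flow is in `C`, it is then in `K`: contradiction. The
analytic core is the chain rule `LocallyLipschitz.deriv_comp_nonpos`. Compactness makes nearby
gradients almost nonpositive on `v`, Fubini integrates this along lines parallel to `v`, and the
Lipschitz bound passes from the tangent line to the curve. -/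

/-- An absolutely continuous function with derivative a.e. at most `c` grows with slope at most
`c`. -/
theorem AbsolutelyContinuousOnInterval.sub_le_mul_of_ae_deriv_le {f : ℝ → ℝ} {a b c : ℝ}
    (hab : a ≤ b) (hf : AbsolutelyContinuousOnInterval f a b)
    (hd : ∀ᵐ t, t ∈ Ioo a b → deriv f t ≤ c) : f b - f a ≤ c * (b - a) := by
  rw [← hf.integral_deriv_eq_sub]
  have h := intervalIntegral.integral_mono_ae_restrict hab
    hf.intervalIntegrable_deriv (intervalIntegrable_const (c := c)) (by
      rw [← Measure.restrict_congr_set Ioo_ae_eq_Icc]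
      exact (ae_restrict_iff' measurableSet_Ioo).2 hd)
  simpa [mul_comm] using h

theorem LipschitzOnWith.comp_absolutelyContinuousOnInterval {X Y : Type*} [PseudoMetricSpace X]
    [PseudoMetricSpace Y] {g : X → Y} {f : ℝ → X} {s : Set X} {L : NNReal} {a b : ℝ}
    (hg : LipschitzOnWith L g s) (hf : AbsolutelyContinuousOnInterval f a b)
    (hs : MapsTo f (uIcc a b) s) : AbsolutelyContinuousOnInterval (g ∘ f) a b := by
  have h0 := Tendsto.const_mul (L : ℝ) hf
  rw [mul_zero] at h0
  refine squeeze_zero' (Eventually.of_forall fun _ => Finset.sum_nonneg fun _ _ => dist_nonneg)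
    ?_ h0
  refine eventually_inf_principal.2 (Eventually.of_forall fun E hE => ?_)
  rw [Finset.mul_sum]
  exact Finset.sum_le_sum fun i hi =>
    hg.dist_le_mul _ (hs (hE.1 i hi).1) _ (hs (hE.1 i hi).2)

/-- Upper semicontinuity of the generalized gradient: if it is in the polar of `v` at `x`, then the
gradients at nearby points are almost in the polar of `v`. -/
theorem LocallyLipschitz.eventually_inner_gradient_le {n : ℕ} {B : EuclideanSpace ℝ (Fin n) → ℝ}
    (hB : LocallyLipschitz B) {Ω : Set (EuclideanSpace ℝ (Fin n))}
    {x v : EuclideanSpace ℝ (Fin n)} (hv : ∀ ζ ∈ clarkeGradient Ω B x, inner ℝ ζ v ≤ 0)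
    {ε : ℝ} (hε : 0 < ε) :
    ∀ᶠ y in 𝓝 x, DifferentiableAt ℝ B y → y ∉ Ω → inner ℝ (gradient B y) v ≤ ε := by
  obtain ⟨L, s, hs, hL⟩ := hB x
  -- Gradients along a bad sequence are bounded by the Lipschitz constant, so a subsequence
  -- converges to a generator of the generalized gradient that violates `hv`.
  by_contra hcon
  obtain ⟨u, hu, hbad⟩ := exists_seq_forall_of_frequently
    ((not_eventually.1 hcon).and_eventually (eventually_eventually_nhds.2 hs))
  have hbd : ∀ i, gradient B (u i) ∈ Metric.closedBall (0 : EuclideanSpace ℝ (Fin n)) L := by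
    intro i
    rw [mem_closedBall_zero_iff, gradient, LinearIsometryEquiv.norm_map]
    exact norm_fderiv_le_of_lipschitzOn ℝ (hbad i).2 hL
  obtain ⟨ζ, -, φ, hφ, hlim⟩ := (isCompact_closedBall _ _).tendsto_subseq hbd
  have hζ : ζ ∈ clarkeGradient Ω B x := by
    refine subset_convexHull ℝ _ ⟨u ∘ φ, hu.comp hφ.tendsto_atTop, fun i => ?_, fun i => ?_, hlim⟩
    · by_contra h
      exact (hbad (φ i)).1 fun h' => absurd h' h
    · intro h
      exact (hbad (φ i)).1 fun _ h' => absurd h h'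
  have hge : ε ≤ inner ℝ ζ v := by
    refine ge_of_tendsto' (hlim.inner tendsto_const_nhds) fun i => ?_
    by_contra! h
    exact (hbad (φ i)).1 fun _ _ => h.le
  linarith [hv ζ hζ]

/-- A bound on the gradients of a Lipschitz function outside a null set bounds its
increments. -/
theorem LipschitzOnWith.sub_le_mul_of_inner_gradient_le {n : ℕ}
    {B : EuclideanSpace ℝ (Fin n) → ℝ} {L : NNReal} {x v : EuclideanSpace ℝ (Fin n)} {r ε : ℝ}
    (hB : LipschitzOnWith L B (Metric.ball x r)) {Ω : Set (EuclideanSpace ℝ (Fin n))}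
    (hΩ : volume Ω = 0)
    (hg : ∀ y ∈ Metric.ball x r, DifferentiableAt ℝ B y → y ∉ Ω → inner ℝ (gradient B y) v ≤ ε)
    {h : ℝ} (h0 : 0 ≤ h) (hr : h * ‖v‖ < r) : B (x + h • v) - B x ≤ ε * h := by
  set S : Set (EuclideanSpace ℝ (Fin n)) :=
    {y | y ∈ Metric.ball x r → DifferentiableAt ℝ B y ∧ y ∉ toMeasurable volume Ω} with hS
  have hSm : MeasurableSet S := by
    have : S = (Metric.ball x r)ᶜ ∪ ({y | DifferentiableAt ℝ B y} ∩ (toMeasurable volume Ω)ᶜ) := by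
      ext y
      simp only [hS, mem_ofPred_eq, mem_union, mem_compl_iff, mem_inter_iff]
      tauto
    rw [this]
    exact Metric.isOpen_ball.measurableSet.compl.union
      ((measurableSet_of_differentiableAt ℝ B).inter (measurableSet_toMeasurable _ _).compl)
  have hSae : ∀ᵐ y, y ∈ S := by
    have h1 : ∀ᵐ y, y ∉ toMeasurable volume Ω :=
      measure_eq_zero_iff_ae_notMem.1 (by rw [measure_toMeasurable, hΩ])
    filter_upwards [h1, hB.ae_differentiableWithinAt_of_mem (μ := volume)] with y hy1 hy2 hy
    exact ⟨(hy2 hy).differentiableAt (Metric.isOpen_ball.mem_nhds hy), hy1⟩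
  -- Fubini: the line through `x` itself may lie in the exceptional set, but almost every parallel
  -- line meets it in a null set.
  have hline : ∀ᵐ y : EuclideanSpace ℝ (Fin n), ∀ᵐ s : ℝ, y + s • v ∈ S :=
    (ae_ae_add_linearMap_mem_iff (LinearMap.toSpanSingleton ℝ _ v) volume volume hSm).2 hSae
  set ρ := r - h * ‖v‖ with hρ
  have hxb : x ∈ Metric.ball x r :=
    Metric.mem_ball_self (lt_of_le_of_lt (by positivity) hr)
  have hseg : ∀ y ∈ Metric.ball x ρ, ∀ s ∈ Icc 0 h, y + s • v ∈ Metric.ball x r := by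
    intro y hy s hs
    rw [mem_ball_iff_norm] at hy ⊢
    have h1 : ‖s • v‖ ≤ h * ‖v‖ := by
      rw [norm_smul, Real.norm_of_nonneg hs.1]
      exact mul_le_mul_of_nonneg_right hs.2 (norm_nonneg _)
    calc ‖y + s • v - x‖ = ‖(y - x) + s • v‖ := by congr 1; abel
      _ ≤ ‖y - x‖ + ‖s • v‖ := norm_add_le _ _
      _ < r := by linarith
  have hgood : ∀ y ∈ Metric.ball x ρ, (∀ᵐ s : ℝ, y + s • v ∈ S) →
      B (y + h • v) - B y ≤ ε * h := by
    intro y hy hys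
    have hlip : AbsolutelyContinuousOnInterval (fun s : ℝ => y + s • v) 0 h := by
      refine LipschitzOnWith.absolutelyContinuousOnInterval (K := ‖v‖₊) ?_
      refine LipschitzOnWith.of_dist_le_mul fun s _ t _ => ?_
      simp [dist_eq_norm, ← sub_smul, norm_smul, mul_comm]
    have hac := hB.comp_absolutelyContinuousOnInterval hlip
      (by rw [uIcc_of_le h0]; exact fun s hs => hseg y hy s hs)
    have := hac.sub_le_mul_of_ae_deriv_le (c := ε) h0 ?_
    · simpa using this
    filter_upwards [hys] with s hs hsI
    have hsb := hseg y hy s (Ioo_subset_Icc_self hsI)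
    obtain ⟨hd, hn⟩ := hs hsb
    have h1 : HasDerivAt (fun s : ℝ => y + s • v) v s := by
      simpa using ((hasDerivAt_id s).smul_const v).const_add y
    rw [(hd.hasFDerivAt.comp_hasDerivAt s h1).deriv]
    have := hg _ hsb hd fun h => hn (subset_toMeasurable _ _ h)
    rwa [gradient, InnerProductSpace.toDual_symm_apply] at this
  -- The good base points are dense, so the bound passes to `x` by continuity of `B`.
  have hxc : x ∈ closure (Metric.ball x ρ ∩ {y | ∀ᵐ s : ℝ, y + s • v ∈ S}) :=
    (Measure.dense_of_ae hline).open_subset_closure_inter Metric.isOpen_ball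
      (Metric.mem_ball_self (by linarith))
  obtain ⟨y, hyS, hyx⟩ := mem_closure_iff_seq_limit.1 hxc
  have hc : ∀ z ∈ Metric.ball x r, ContinuousAt B z := fun z hz =>
    hB.continuousOn.continuousAt (Metric.isOpen_ball.mem_nhds hz)
  refine le_of_tendsto' (((hc _ (hseg x (Metric.mem_ball_self (by linarith)) h
    ⟨h0, le_rfl⟩)).tendsto.comp (hyx.add_const _)).sub ((hc x hxb).tendsto.comp hyx)) fun i => ?_
  exact hgood _ (hyS i).1 (hyS i).2

/-- The gradient bound holds on a whole ball, and the segment from `x` to `x + h • v` stays in that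
ball for small `h`. -/
theorem LocallyLipschitz.eventually_sub_le_mul {n : ℕ} {B : EuclideanSpace ℝ (Fin n) → ℝ}
    (hB : LocallyLipschitz B) {Ω : Set (EuclideanSpace ℝ (Fin n))} (hΩ : volume Ω = 0)
    {x v : EuclideanSpace ℝ (Fin n)} (hv : ∀ ζ ∈ clarkeGradient Ω B x, inner ℝ ζ v ≤ 0)
    {ε : ℝ} (hε : 0 < ε) : ∀ᶠ h in 𝓝[>] (0 : ℝ), B (x + h • v) - B x ≤ ε * h := by
  obtain ⟨L, s, hs, hL⟩ := hB x
  obtain ⟨r, hr, hrs⟩ := Metric.mem_nhds_iff.1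
    (inter_mem hs (hB.eventually_inner_gradient_le hv hε))
  have hlim : Tendsto (fun h : ℝ => h * ‖v‖) (𝓝[>] 0) (𝓝 0) :=
    tendsto_nhdsWithin_of_tendsto_nhds (by
      simpa using (continuous_id.mul continuous_const).tendsto (0 : ℝ) (f := fun h : ℝ => h * ‖v‖))
  filter_upwards [self_mem_nhdsWithin, hlim.eventually_lt_const hr] with h h0 hh
  exact (hL.mono fun y hy => (hrs hy).1).sub_le_mul_of_inner_gradient_le hΩ
    (fun y hy => (hrs hy).2) (le_of_lt h0) hh

/-- Chain rule inequality for the Clarke gradient along a differentiable curve. -/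
theorem LocallyLipschitz.deriv_comp_nonpos {n : ℕ} {B : EuclideanSpace ℝ (Fin n) → ℝ}
    (hB : LocallyLipschitz B) {Ω : Set (EuclideanSpace ℝ (Fin n))} (hΩ : volume Ω = 0)
    {γ : ℝ → EuclideanSpace ℝ (Fin n)} {v : EuclideanSpace ℝ (Fin n)} {t : ℝ}
    (hγ : HasDerivAt γ v t) (hv : ∀ ζ ∈ clarkeGradient Ω B (γ t), inner ℝ ζ v ≤ 0) :
    deriv (B ∘ γ) t ≤ 0 := by
  by_cases hd : DifferentiableAt ℝ (B ∘ γ) t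
  swap
  -- `deriv` is `0` by convention here.
  · rw [deriv_zero_of_not_differentiableAt hd]
  have h1 := hd.hasDerivAt.tendsto_slope_zero_right
  refine le_of_forall_pos_le_add fun ε hε => ?_
  obtain ⟨L, s, hs, hL⟩ := hB (γ t)
  -- Difference quotients of `B ∘ γ` are at most `ε`, from the tangent line, plus `L` times the
  -- error of the tangent approximation.
  have h2 : Tendsto (fun h : ℝ => ε + L * ‖h⁻¹ • (γ (t + h) - γ t) - v‖) (𝓝[>] 0) (𝓝 (ε + L * 0)) := by
    refine ((tendsto_const_nhds).mul ?_).const_add _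
    have := (hγ.tendsto_slope_zero_right.sub_const v).norm
    simpa using this
  rw [mul_zero] at h2
  rw [zero_add]
  rw [add_zero] at h2
  have hid : Tendsto (fun h : ℝ => h) (𝓝[>] 0) (𝓝 0) := nhdsWithin_le_nhds
  have h3 : ∀ᶠ h in 𝓝[>] (0 : ℝ), γ (t + h) ∈ s := by
    have : Tendsto (fun h : ℝ => γ (t + h)) (𝓝[>] 0) (𝓝 (γ t)) :=
      hγ.continuousAt.tendsto.comp (by simpa using hid.const_add t)
    exact this hs
  have h4 : ∀ᶠ h in 𝓝[>] (0 : ℝ), γ t + h • v ∈ s := by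
    have : Tendsto (fun h : ℝ => γ t + h • v) (𝓝[>] 0) (𝓝 (γ t)) := by
      simpa using (hid.smul_const v).const_add (γ t)
    exact this hs
  refine le_of_tendsto_of_tendsto h1 h2 ?_
  filter_upwards [h3, h4, hB.eventually_sub_le_mul hΩ hv hε, self_mem_nhdsWithin]
    with h h3 h4 h5 (h0 : 0 < h)
  have h6 : B (γ (t + h)) - B (γ t + h • v) ≤ L * ‖γ (t + h) - (γ t + h • v)‖ := by
    have := hL.dist_le_mul _ h3 _ h4
    rw [Real.dist_eq, dist_eq_norm] at this
    exact (le_abs_self _).trans this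
  have h7 : ‖γ (t + h) - (γ t + h • v)‖ = h * ‖h⁻¹ • (γ (t + h) - γ t) - v‖ := by
    have : ‖h • (h⁻¹ • (γ (t + h) - γ t) - v)‖ = h * ‖h⁻¹ • (γ (t + h) - γ t) - v‖ := by
      rw [norm_smul, Real.norm_of_nonneg h0.le]
    rw [← this, smul_sub, smul_smul, mul_inv_cancel₀ h0.ne', one_smul, sub_add_eq_sub_sub]
  rw [h7] at h6
  simp only [Function.comp_apply, smul_eq_mul]
  rw [inv_mul_le_iff₀ h0]
  linarith

/-- The velocity of a curve that stays in `S` is in the contingent cone of `S`. -/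
theorem HasDerivAt.mem_contingentCone {n : ℕ} {S : Set (EuclideanSpace ℝ (Fin n))}
    {γ : ℝ → EuclideanSpace ℝ (Fin n)} {v : EuclideanSpace ℝ (Fin n)} {t : ℝ}
    (hγ : HasDerivAt γ v t) (hS : ∀ᶠ s in 𝓝[>] t, γ s ∈ S) : v ∈ contingentCone S (γ t) := by
  have h1 : Tendsto (fun h : ℝ => ENNReal.ofReal ‖h⁻¹ • (γ (t + h) - γ t) - v‖) (𝓝[>] 0) (𝓝 0) := by
    have := (hγ.tendsto_slope_zero_right.sub_const v).norm
    simpa using ENNReal.tendsto_ofReal this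
  have h2 : ∀ᶠ h in 𝓝[>] (0 : ℝ), γ (t + h) ∈ S := by
    have : Tendsto (fun h : ℝ => t + h) (𝓝[>] 0) (𝓝[>] t) := by
      refine tendsto_nhdsWithin_iff.2 ⟨?_, ?_⟩
      · have hid : Tendsto (fun h : ℝ => h) (𝓝[>] 0) (𝓝 0) := nhdsWithin_le_nhds
        simpa using hid.const_add t
      · filter_upwards [self_mem_nhdsWithin] with h (h0 : 0 < h)
        simpa using h0
    exact this hS
  refine Tendsto.liminf_eq (tendsto_of_tendsto_of_tendsto_of_le_of_le' tendsto_const_nhds h1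
    (Eventually.of_forall fun _ => zero_le) ?_)
  filter_upwards [h2, self_mem_nhdsWithin] with h h2 (h0 : 0 < h)
  have h7 : ‖γ t + h • v - γ (t + h)‖ = ‖h⁻¹ • (γ (t + h) - γ t) - v‖ * h := by
    have : ‖h • (h⁻¹ • (γ (t + h) - γ t) - v)‖ = h * ‖h⁻¹ • (γ (t + h) - γ t) - v‖ := by
      rw [norm_smul, Real.norm_of_nonneg h0.le]
    rw [mul_comm, ← this, smul_sub, smul_smul, mul_inv_cancel₀ h0.ne', one_smul, norm_sub_rev,
      sub_add_eq_sub_sub]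
  refine ENNReal.div_le_of_le_mul ?_
  rw [← ENNReal.ofReal_mul (norm_nonneg _), ← h7, ← dist_eq_norm, ← edist_dist]
  exact Metric.infEDist_le_edist_of_mem h2

/-- Every point of a hybrid time domain lies on a flow interval that starts at time `0` or right
after a jump. -/
theorem IsHybridTimeDomain.exists_flow_start {E : Set (ℝ × ℕ)} (hE : IsHybridTimeDomain E)
    {t : ℝ} {j : ℕ} (ht : (t, j) ∈ E) :
    ∃ τ ≤ t, Icc τ t ⊆ timeSlice E j ∧ (j = 0 → τ = 0) ∧ ∀ k, j = k + 1 → (τ, k) ∈ E := by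
  obtain ⟨σ, hσ0, hσ, hEσ⟩ := hE.2.2 t j ht
  have hmem : ∀ s k, ((s, k) ∈ E ∧ (0 ≤ s ∧ s ≤ t) ∧ k ≤ j) ↔
      k ≤ j ∧ σ k ≤ s ∧ s ≤ σ (k + 1) := by
    intro s k
    have := Set.ext_iff.1 hEσ (s, k)
    simpa [and_comm, and_left_comm] using this
  have htj := (hmem t j).1 ⟨ht, ⟨hE.2.1 _ ht, le_rfl⟩, le_rfl⟩
  refine ⟨σ j, htj.2.1, fun s hs => ?_, fun h => by rw [h, hσ0], fun k hk => ?_⟩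
  · exact ((hmem s j).2 ⟨le_rfl, hs.1, hs.2.trans htj.2.2⟩).1
  · subst hk
    exact ((hmem _ k).2 ⟨Nat.le_succ k, hσ k (Nat.le_succ k), le_rfl⟩).1

/-- A flow that starts in `K` stays in `K`. -/
theorem HybridSystem.IsSolution.flow_mem_of_mem {n : ℕ} {H : HybridSystem n} {x : HybridArc n}
    (hx : H.IsSolution x) {K : Set (EuclideanSpace ℝ (Fin n))} (hK : IsClosed K)
    {B : EuclideanSpace ℝ (Fin n) → ℝ} (hB : LocallyLipschitz B)
    (hBK : H.IsBarrierCandidate B K) {Ω : Set (EuclideanSpace ℝ (Fin n))} (hΩ : volume Ω = 0)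
    {U : Set (EuclideanSpace ℝ (Fin n))} (hU : IsOpen U) (hKU : frontier K ⊆ U)
    (hflow : ∀ y ∈ (U \ K) ∩ H.C, ∀ η ∈ H.F y ∩ contingentCone H.C y,
      ∀ ζ ∈ clarkeGradient Ω B y, inner ℝ ζ η ≤ 0)
    {j : ℕ} {a b : ℝ} (hab : a ≤ b) (hI : Icc a b ⊆ timeSlice x.dom j) (ha : x.val a j ∈ K) :
    x.val b j ∈ K := by
  by_contra hb
  have hac := x.absolutelyContinuous j a b hab hI
  have hcont : ContinuousOn (fun t => x.val t j) (Icc a b) := by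
    simpa [uIcc_of_le hab] using hac.continuousOn
  -- `s` is the last time in `K`
  set A := Icc a b ∩ (fun t => x.val t j) ⁻¹' K with hA
  have hAc : IsCompact A := isCompact_Icc.of_isClosed_subset
    (hcont.preimage_isClosed_of_isClosed isClosed_Icc hK) inter_subset_left
  obtain ⟨s, ⟨⟨has, hsb⟩, hsK⟩, hsmax⟩ := hAc.exists_isGreatest ⟨a, ⟨le_rfl, hab⟩, ha⟩
  have hsb' : s < b := lt_of_le_of_ne hsb fun h => hb (h ▸ hsK)
  have hout : ∀ t ∈ Ioc s b, x.val t j ∉ K := fun t ht hmem =>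
    absurd (hsmax ⟨⟨has.trans ht.1.le, ht.2⟩, hmem⟩) (not_le.2 ht.1)
  have hright : Tendsto (fun t => x.val t j) (𝓝[>] s) (𝓝 (x.val s j)) := by
    refine (hcont s ⟨has, hsb⟩).mono_left ?_
    rw [← nhdsWithin_Ioo_eq_nhdsGT hsb']
    exact nhdsWithin_mono _ fun t ht => ⟨has.trans ht.1.le, ht.2.le⟩
  have hfr : x.val s j ∈ frontier K := by
    rw [frontier_eq_closure_inter_closure]
    refine ⟨subset_closure hsK, mem_closure_of_tendsto hright ?_⟩
    filter_upwards [Ioc_mem_nhdsGT hsb'] with t ht using hout t ht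
  obtain ⟨L, W, hW, hL⟩ := hB (x.val s j)
  have hev := hright (inter_mem hW (hU.mem_nhds (hKU hfr)))
  obtain ⟨c, hsc, hc⟩ := (mem_nhdsGT_iff_exists_Ioc_subset).1
    (inter_mem hev (Ioo_mem_nhdsGT hsb'))
  rw [mem_Ioi] at hsc
  -- Solutions need to be in `C` only at interior times, so the contradiction is sought at `c < b`
  -- rather than at `b`.
  have hcb : c < b := (hc ⟨hsc, le_rfl⟩).2.2
  have hsub : Icc s c ⊆ Icc a b := Icc_subset_Icc has hcb.le
  have hint : Ioo a b ⊆ interior (timeSlice x.dom j) :=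
    interior_maximal (Ioo_subset_Icc_self.trans hI) isOpen_Ioo
  have hc_int : c ∈ Ioo a b := ⟨has.trans_lt hsc, hcb⟩
  have hne : (interior (timeSlice x.dom j)).Nonempty := ⟨c, hint hc_int⟩
  have hCc : ∀ t ∈ Ioo a b, x.val t j ∈ H.C := fun t ht => hx.flow_mem j hne t (hint ht)
  have hacB : AbsolutelyContinuousOnInterval (B ∘ fun t => x.val t j) s c := by
    refine hL.comp_absolutelyContinuousOnInterval (hac.mono ?_) fun t ht => ?_
    · rwa [uIcc_of_le hsc.le, uIcc_of_le hab]
    · rw [uIcc_of_le hsc.le] at ht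
      rcases ht.1.eq_or_lt with rfl | hlt
      · exact mem_of_mem_nhds hW
      · exact (hc ⟨hlt, ht.2⟩).1.1
  have hle := hacB.sub_le_mul_of_ae_deriv_le (c := 0) hsc.le ?_
  · rw [hBK] at hsK
    have hBs : B (x.val s j) ≤ 0 := hsK.2
    refine hout c ⟨hsc, hcb.le⟩ ?_
    rw [hBK]
    refine ⟨Or.inl (hCc c hc_int), ?_⟩
    simp only [Function.comp_apply, zero_mul] at hle
    linarith
  filter_upwards [hx.flow_deriv j hne] with t ht htI
  have htab : t ∈ Ioo a b := ⟨has.trans_lt htI.1, htI.2.trans hcb⟩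
  obtain ⟨v, hvF, hv⟩ := ht (hI (Ioo_subset_Icc_self htab))
  have hv' := hv.hasDerivAt (mem_interior_iff_mem_nhds.1 (hint htab))
  refine hB.deriv_comp_nonpos hΩ hv' (hflow _
    ⟨⟨(hc ⟨htI.1, htI.2.le⟩).1.2, hout t ⟨htI.1, (htI.2.trans hcb).le⟩⟩, hCc t htab⟩ v ⟨hvF, ?_⟩)
  refine hv'.mem_contingentCone ?_
  filter_upwards [mem_nhdsWithin_of_mem_nhds (isOpen_Ioo.mem_nhds htab)] with r hr using hCc r hr

theorem theorem4 (n : ℕ) (H : HybridSystem n) (hH : H.Regular)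
    (K : Set (EuclideanSpace ℝ (Fin n))) (hK : IsClosed K)
    (B : EuclideanSpace ℝ (Fin n) → ℝ) (hB : LocallyLipschitz B)
    (hBK : H.IsBarrierCandidate B K)
    (hjump_nonpos : ∀ x ∈ H.D ∩ K, ∀ η ∈ H.G x, B η ≤ 0)
    (hjump_mem : ∀ x ∈ H.D ∩ K, H.G x ⊆ H.C ∪ H.D)
    (Ω : Set (EuclideanSpace ℝ (Fin n))) (hΩ : volume Ω = 0)
    (hflow : ∃ U : Set (EuclideanSpace ℝ (Fin n)), IsOpen U ∧ frontier K ⊆ U ∧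
      ∀ x ∈ (U \ K) ∩ H.C, ∀ η ∈ H.F x ∩ contingentCone H.C x,
        ∀ ζ ∈ clarkeGradient Ω B x, inner ℝ ζ η ≤ 0) :
    H.ForwardPreInvariant K := by
  obtain ⟨U, hU, hKU, hflow⟩ := hflow
  intro x₀ hx₀ x hx hinit t j
  induction j generalizing t with
  | zero =>
    intro ht
    obtain ⟨τ, hτ, hI, h0, -⟩ := x.isHybridTimeDomain.exists_flow_start ht
    refine hx.1.flow_mem_of_mem hK hB hBK hΩ hU hKU hflow hτ hI ?_
    rwa [h0 rfl, hinit]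
  | succ k ih =>
    intro ht
    obtain ⟨τ, hτ, hI, -, hk⟩ := x.isHybridTimeDomain.exists_flow_start ht
    refine hx.1.flow_mem_of_mem hK hB hBK hΩ hU hKU hflow hτ hI ?_
    have hτk := hk k rfl
    obtain ⟨hD, hG⟩ := hx.1.jump τ k hτk (hI ⟨le_rfl, hτ⟩)
    have hmem : x.val τ k ∈ H.D ∩ K := ⟨hD, ih τ hτk⟩
    rw [hBK]
    exact ⟨hjump_mem _ hmem hG, hjump_nonpos _ hmem _ hG⟩
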